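/- \textbf{Conventions.} We work in continuous first-order logic with $[0,1]$-valued predicates (single-sorted). A structure $\mathbf M$ is a non-empty complete metric space $M$ of diameter at most $1$ together with functions and $[0,1]$-valued predicates interpreting the symbols of the language, each obeying the modulus of uniform continuity prescribed by the language. Formulae are built from the atomic formulae $R(t_1,\dots,t_k)$ and $d(t_1,t_2)$ by means of continuous connectives $[0,1]^k\to[0,1]$ and the quantifiers $\sup$ and $\inf$. Classical logic is the special case in which the metric is discrete and predicates are $\{0,1\}$-valued, with $0$ standing for truth. Let $\varphi(x,y)$ be a formula, where $x$ and $y$ are disjoint finite tuples of variables, and let $\tilde\varphi(y,x)=\varphi(x,y)$. Let $\mathbf M$ be a structure; below, $a$ and $b$ (possibly with indices) denote tuples in $M$ of the lengths of $x$ and $y$, respectively. \begin{itemize} \item The formula $\varphi$ is \emph{stable in $\mathbf M$} if for all sequences $(a_n)$, $(b_m)$ of tuples in $M$, $\lim_n\lim_m\varphi(a_n,b_m)=\lim_m\lim_n\varphi(a_n,b_m)$ as soon as both iterated limits exist. \item If $c$ is a tuple in an elementary extension of $\mathbf M$, its \emph{$\varphi$-type} $\mathrm{tp}_\varphi(c/M)$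 over $M$ is the function $b\mapsto\varphi(c,b)$ on tuples $b$ in $M$. The set of all $\varphi$-types over $M$ is denoted by $S_\varphi(M)$. For $p\in S_\varphi(M)$ write $\varphi(p,b)=\varphi^b(p)=p(b)$, and equip $S_\varphi(M)$ with the least topology in which all the functions $\varphi^b$ are continuous; it is compact and Hausdorff. The types $\mathrm{tp}_\varphi(a/M)$ with $a$ in $M$ are called \emph{realised}. The same notions apply to $\tilde\varphi$. For $a$ in $M$ let $\varphi_a=\tilde\varphi^a\colon S_{\tilde\varphi}(M)\to[0,1]$, $q\mapsto\varphi(a,q)$. \item A \emph{$\tilde\varphi$-predicate over $M$} is a function $\psi\colon S_{\tilde\varphi}(M)\to[0,1]$ of the form $\psi=\theta\bigl((\varphi_{a_i})_{i\in\mathbb N}\bigr)$ with $a_i$ in $M$ and $\theta\colon[0,1]^{\mathbb N}\to[0,1]$ continuous. For $b$ in $M$ put $\psi(b)=\psi(\mathrm{tp}_{\tilde\varphi}(b/M))$. It \emph{defines} $p\in S_\varphi(M)$, or is a \emph{definition} of $p$, if $\varphi(p,b)=\psi(b)$ for all $b$ in $M$. \item $C(S_{\tilde\varphi}(M))$ is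 the Banach space of continuous complex-valued functions on $S_{\tilde\varphi}(M)$ with the supremum norm. \end{itemize} \textbf{Theorem.} Let $\varphi(x,y)$ be a formula and $\mathbf M$ a structure. Then the following are equivalent. \begin{enumerate} \item[(i)] The formula $\varphi$ is stable in $\mathbf M$. \item[(ii)] Every $p\in S_\varphi(M)$ is definable by a $\tilde\varphi$-predicate $\psi_p$ over $M$, and the map $p\mapsto\psi_p$ is a homeomorphic embedding of $S_\varphi(M)$ into $C(S_{\tilde\varphi}(M))$ equipped with its weak topology. \item[(iii)] Whenever $(a_n)$ is a sequence of tuples in $M$ and $p\in S_\varphi(M)$ is an accumulation point (cluster point) of the sequence $\bigl(\mathrm{tp}_\varphi(a_n/M)\bigr)_n$, there is a sub-sequence $(a_{n_k})$ such that $\varphi_{a_{n_k}}$ converges point-wise on $S_{\tilde\varphi}(M)$ to a $\tilde\varphi$-predicate over $M$ that is a definition of $p$. \end{enumerate} Moreover, in this case every $p\in S_\varphi(M)$ is the limit in $S_\varphi(M)$ of a sequence of realised types. -/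

import Mathlib

open Filter Topology unitInterval
open scoped BoundedContinuousFunction

universe u v w

noncomputable section

namespace ContLogic

/-- A (single-sorted) language for continuous first order logic: function and predicate symbols with
their arities, each of them with a prescribed modulus of uniform continuity. -/
structure Language extends FirstOrder.Language.{u, v} where
  /-- the modulus of uniform continuity of a function symbol -/
  funModulus : ∀ {n : ℕ}, Functions n → ℝ → ℝ
  funModulus_pos : ∀ {n : ℕ} (f : Functions n) (ε : ℝ), 0 < ε → 0 < funModulus f ε
  /-- the modulus of uniform continuity of a predicate symbol -/
  relModulus : ∀ {n : ℕ}, Relations n → ℝ → ℝ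
  relModulus_pos : ∀ {n : ℕ} (R : Relations n) (ε : ℝ), 0 < ε → 0 < relModulus R ε

/-- A structure of continuous logic: a non-empty complete metric space of diameter at most `1`,
with an interpretation of the function symbols by functions and of the predicate symbols by
`[0,1]`-valued functions, which obey the prescribed moduli of uniform continuity (with respect to
the maximum distance on tuples). -/
class Structure (L : Language.{u, v}) (M : Type w) [MetricSpace M] where
  nonempty : Nonempty M
  complete : CompleteSpace M
  dist_le_one : ∀ x y : M, dist x y ≤ 1
  funMap : ∀ {n : ℕ}, L.Functions n → (Fin n → M) → M
  relMap : ∀ {n : ℕ}, L.Relations n → (Fin n → M) → I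
  funMap_modulus : ∀ {n : ℕ} (f : L.Functions n) (ε : ℝ), 0 < ε → ∀ x y : Fin n → M,
    (∀ i, dist (x i) (y i) < L.funModulus f ε) → dist (funMap f x) (funMap f y) ≤ ε
  relMap_modulus : ∀ {n : ℕ} (R : L.Relations n) (ε : ℝ), 0 < ε → ∀ x y : Fin n → M,
    (∀ i, dist (x i) (y i) < L.relModulus R ε) → dist (relMap R x) (relMap R y) ≤ ε

/-- Formulae with free variables indexed by `α`, and `n` further variables (indexed by `Fin n`)
available for quantification. Connectives are all continuous functions `[0,1]^k → [0,1]`,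
quantifiers are `sup` and `inf`, and the distance plays the role of equality. -/
inductive BoundedFormula (L : Language.{u, v}) (α : Type) : ℕ → Type (max u v)
  | rel {n l : ℕ} (R : L.Relations l) (ts : Fin l → L.toLanguage.Term (α ⊕ Fin n)) :
      BoundedFormula L α n
  | dist {n : ℕ} (t₁ t₂ : L.toLanguage.Term (α ⊕ Fin n)) : BoundedFormula L α n
  | conn {n k : ℕ} (c : C(Fin k → I, I)) (φs : Fin k → BoundedFormula L α n) :
      BoundedFormula L α n
  | sup {n : ℕ} (φ : BoundedFormula L α (n + 1)) : BoundedFormula L α n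
  | inf {n : ℕ} (φ : BoundedFormula L α (n + 1)) : BoundedFormula L α n

/-- Formulae whose free variables are indexed by `α`. -/
abbrev Formula (L : Language.{u, v}) (α : Type) : Type (max u v) := BoundedFormula L α 0

/-- Renaming of the free variables. -/
def BoundedFormula.relabel {L : Language.{u, v}} {α β : Type} (g : α → β) :
    {n : ℕ} → BoundedFormula L α n → BoundedFormula L β n
  | _, .rel R ts => .rel R fun i => (ts i).relabel (Sum.map g id)
  | _, .dist t₁ t₂ => .dist (t₁.relabel (Sum.map g id)) (t₂.relabel (Sum.map g id))
  | _, .conn c φs => .conn c fun i => (φs i).relabel g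
  | _, .sup φ => .sup (φ.relabel g)
  | _, .inf φ => .inf (φ.relabel g)

section Semantics

variable {L : Language.{u, v}} {M : Type w} [MetricSpace M] [Structure L M]

/-- The value of a term under an assignment of the variables. -/
def termValue {α : Type} (x : α → M) : L.toLanguage.Term α → M
  | .var i => x i
  | .func f ts => Structure.funMap (L := L) f fun i => termValue x (ts i)

/-- The value in `[0,1]` of a formula; the value `0` stands for truth. -/
def BoundedFormula.value {α : Type} : {n : ℕ} → BoundedFormula L α n → (α → M) → (Fin n → M) → I
  | _, .rel R ts, x, z => Structure.relMap R fun i => termValue (Sum.elim x z) (ts i)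
  | _, .dist t₁ t₂, x, z =>
      ⟨Dist.dist (termValue (Sum.elim x z) t₁) (termValue (Sum.elim x z) t₂),
        dist_nonneg, Structure.dist_le_one L _ _⟩
  | _, .conn c φs, x, z => c fun i => (φs i).value x z
  | _, .sup φ, x, z => ⨆ a : M, φ.value x (Fin.snoc z a)
  | _, .inf φ, x, z => ⨅ a : M, φ.value x (Fin.snoc z a)

/-- The value `φ(x)` in the structure of a formula at a tuple. -/
def Formula.eval {α : Type} (φ : Formula L α) (x : α → M) : I :=
  BoundedFormula.value φ x Fin.elim0

end Semantics

/-- An elementary embedding: it preserves the values of all formulae. A structure `N` together with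
an elementary embedding of `M` in it is an elementary extension of `M` (up to renaming). -/
structure ElementaryEmbedding (L : Language.{u, v}) (M N : Type w) [MetricSpace M] [MetricSpace N]
    [Structure L M] [Structure L N] where
  toFun : M → N
  map_formula : ∀ (k : ℕ) (ψ : Formula L (Fin k)) (x : Fin k → M),
    ψ.eval (toFun ∘ x) = ψ.eval x

section Types

variable {L : Language.{u, v}} {m n : ℕ}

/-- The value `φ(a, b)` of a formula `φ(x, y)`, where `x` is an `m`-tuple of variables and `y` an
`n`-tuple. -/
def Formula.eval₂ {M : Type w} [MetricSpace M] [Structure L M]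
    (φ : Formula L (Fin m ⊕ Fin n)) (a : Fin m → M) (b : Fin n → M) : I :=
  φ.eval (Sum.elim a b)

/-- The formula `φ̃(y, x) = φ(x, y)`. -/
def Formula.swap (φ : Formula L (Fin m ⊕ Fin n)) : Formula L (Fin n ⊕ Fin m) :=
  BoundedFormula.relabel Sum.swap φ

theorem termValue_relabel {M : Type w} [MetricSpace M] [Structure L M] {α β : Type} (g : α → β)
    (x : β → M) (t : L.toLanguage.Term α) :
    termValue (L := L) x (t.relabel g) = termValue (L := L) (x ∘ g) t := by
  induction t with
  | var i => rfl
  | func f ts ih =>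
    simp only [FirstOrder.Language.Term.relabel, termValue]
    exact congrArg _ (funext ih)

theorem value_relabel {M : Type w} [MetricSpace M] [Structure L M] {α β : Type} (g : α → β)
    (x : β → M) {k : ℕ} (φ : BoundedFormula L α k) (z : Fin k → M) :
    (φ.relabel g).value x z = φ.value (x ∘ g) z := by
  have key : ∀ {k : ℕ} (z : Fin k → M),
      Sum.elim x z ∘ Sum.map g id = Sum.elim (x ∘ g) z := by
    intro k z
    funext i
    cases i <;> rfl
  induction φ with
  | rel R ts => simp only [BoundedFormula.relabel, BoundedFormula.value, termValue_relabel, key]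
  | dist t₁ t₂ => simp only [BoundedFormula.relabel, BoundedFormula.value, termValue_relabel, key]
  | conn c φs ih => simp only [BoundedFormula.relabel, BoundedFormula.value, ih]
  | sup φ ih => simp only [BoundedFormula.relabel, BoundedFormula.value, ih]
  | inf φ ih => simp only [BoundedFormula.relabel, BoundedFormula.value, ih]

theorem Formula.eval₂_swap {M : Type w} [MetricSpace M] [Structure L M]
    (φ : Formula L (Fin m ⊕ Fin n)) (a : Fin m → M) (b : Fin n → M) :
    φ.swap.eval₂ b a = φ.eval₂ a b := by
  unfold Formula.eval₂ Formula.swap Formula.eval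
  rw [value_relabel]
  congr 1
  funext i
  cases i <;> rfl

/-- The formula `φ(x, y)` is stable in the structure `M`: for all sequences of tuples `a_k`, `b_l`
in `M`, the iterated limits of `φ(a_k, b_l)` agree as soon as both exist. -/
def Formula.StableIn (φ : Formula L (Fin m ⊕ Fin n)) (M : Type w) [MetricSpace M]
    [Structure L M] : Prop :=
  ∀ (a : ℕ → Fin m → M) (b : ℕ → Fin n → M) (f g : ℕ → I) (r s : I),
    (∀ k, Tendsto (fun l => φ.eval₂ (a k) (b l)) atTop (𝓝 (f k))) → Tendsto f atTop (𝓝 r) →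
    (∀ l, Tendsto (fun k => φ.eval₂ (a k) (b l)) atTop (𝓝 (g l))) → Tendsto g atTop (𝓝 s) →
    r = s

/-- `p` is the `φ`-type over `M` of some tuple `a` in some elementary extension `N` of `M`, i.e. the
function which associates to the instance `φ(x, b)`, where `b` is a tuple in `M`, the value
`φ(a, b)`. -/
def IsPhiType (φ : Formula L (Fin m ⊕ Fin n)) (M : Type w) [MetricSpace M] [Structure L M]
    (p : (Fin n → M) → I) : Prop :=
  ∃ (N : Type w) (_ : MetricSpace N) (_ : Structure L N) (e : ElementaryEmbedding L M N)
    (a : Fin m → N), ∀ b : Fin n → M, p b = φ.eval₂ a (e.toFun ∘ b)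

/-- The space `S_φ(M)` of `φ`-types over `M`. It carries the subspace topology of a product, that
is, the least topology in which the evaluations `p ↦ φ(p, b)` are continuous. -/
abbrev PhiType (φ : Formula L (Fin m ⊕ Fin n)) (M : Type w) [MetricSpace M]
    [Structure L M] : Type w :=
  {p : (Fin n → M) → I // IsPhiType φ M p}

variable {M : Type w} [MetricSpace M] [Structure L M]

/-- The `φ`-type `tp_φ(a/M)` of a tuple `a` in `M`; these are the realised types. -/
def typeOf (φ : Formula L (Fin m ⊕ Fin n)) (a : Fin m → M) : PhiType φ M :=
  ⟨fun b => φ.eval₂ a b, M, inferInstance, inferInstance, ⟨id, fun _ _ _ => rfl⟩, a, fun _ => rfl⟩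

/-- The function `φ^b : p ↦ φ(p, b)` on `S_φ(M)`. -/
def PhiType.ev {φ : Formula L (Fin m ⊕ Fin n)} (b : Fin n → M) (p : PhiType φ M) : I :=
  p.1 b

theorem PhiType.continuous_ev {φ : Formula L (Fin m ⊕ Fin n)} (b : Fin n → M) :
    Continuous (PhiType.ev (φ := φ) b) :=
  (continuous_apply b).comp continuous_subtype_val

/-- A `φ`-predicate over `M`, viewed as a function on `S_φ(M)`: a continuous combination of
countably many functions of the form `φ^b`, where `b` is a tuple in `M`. -/
structure PhiPredicate (φ : Formula L (Fin m ⊕ Fin n)) (M : Type w) [MetricSpace M]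
    [Structure L M] where
  toFun : PhiType φ M → I
  isCombination : ∃ (b : ℕ → Fin n → M) (θ : C(ℕ → I, I)),
    ∀ p, toFun p = θ fun i => PhiType.ev (b i) p

variable {φ : Formula L (Fin m ⊕ Fin n)}

theorem PhiPredicate.continuous (ψ : PhiPredicate φ M) : Continuous ψ.toFun := by
  obtain ⟨b, θ, h⟩ := ψ.isCombination
  rw [show ψ.toFun = fun p => θ fun i => PhiType.ev (b i) p from funext h]
  exact θ.continuous.comp (continuous_pi fun i => PhiType.continuous_ev (b i))

/-- The value `ψ(a)` of a `φ`-predicate at a tuple in `M`. -/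
def PhiPredicate.eval (ψ : PhiPredicate φ M) (a : Fin m → M) : I :=
  ψ.toFun (typeOf φ a)

/-- A `φ`-predicate as an element of the Banach space of bounded continuous complex functions on
`S_φ(M)`. (As `S_φ(M)` is compact, all continuous functions on it are bounded.) -/
def PhiPredicate.toBCF (ψ : PhiPredicate φ M) : PhiType φ M →ᵇ ℂ :=
  BoundedContinuousFunction.ofNormedAddCommGroup (fun p => ((ψ.toFun p : ℝ) : ℂ))
    (Complex.continuous_ofReal.comp (continuous_subtype_val.comp ψ.continuous)) 1 (fun p => by
      rw [Complex.norm_real, Real.norm_of_nonneg (ψ.toFun p).2.1]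
      exact (ψ.toFun p).2.2)

/-- The `φ̃`-predicate `ψ(y)` over `M` defines the `φ`-type `p`: `φ(p, b) = ψ(b)` for all tuples `b`
in `M`. -/
def PhiPredicate.Defines (ψ : PhiPredicate φ.swap M) (p : PhiType φ M) : Prop :=
  ∀ b : Fin n → M, PhiType.ev b p = ψ.eval b

end Types

end ContLogic

end

/-! The proof is Grothendieck's double limit argument. By Łoś's theorem and elementarity, `PhiType φ
M` is the closure of the realised types in a product of intervals
(`isPhiType_iff_mem_closure_range`), hence a compact space in which realised types are dense.
Stability is the exchange of iterated limits on the dense parts of the two type spaces, and it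
allows `φ` to be extended to a separately continuous function `Φ` of a `φ`-type and a `φ̃`-type
(`exists_separately_continuous_extension`). The definition of `p` is `Φ p`.

Two facts turn separate continuity into the theorem. By the angelic property
(`exists_seq_tendsto_of_mapClusterPt`), cluster points are sequential limits for pointwise
convergence. Hence `Φ p` is a pointwise limit of countably many instances and a continuous
combination of them, and `p` is a limit of realised types. By Riesz representation and dominated
convergence, bounded pointwise convergence of sequences implies weak convergence
(`tendsto_functional_of_pointwise`), so `p ↦ Φ p` is weakly continuous, and an embedding by
compactness.

Conversely, point evaluations are weakly continuous, so (ii) gives back separate continuity and the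
angelic property gives (iii). Under (iii), both iterated limits equal the value of one definition at
a limit of the types of the `b l`. -/

namespace ContLogic

/-! ### Double limits, separate continuity and the angelic property -/

section Topology

/-- Recursive choice of a sequence, each term depending on the list of the previous ones. -/
theorem exists_seq_of_forall_list_exists {J : Type*} (P : List J → J → Prop)
    (h : ∀ l, ∃ k, P l k) : ∃ s : ℕ → J, ∀ n, P ((List.range n).map s) (s n) := by
  choose c hc using h
  let hist : ℕ → List J := fun n => Nat.rec [] (fun _ l => l ++ [c l]) n
  have hist_eq : ∀ n, hist n = (List.range n).map fun k => c (hist k) := by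
    intro n
    induction n with
    | zero => rfl
    | succ n ih =>
      rw [List.range_succ, List.map_append, ← ih]
      rfl
  refine ⟨fun n => c (hist n), fun n => ?_⟩
  rw [← hist_eq]
  exact hc _

theorem tendsto_of_eventually_dist_lt_one_div {E : Type*} [PseudoMetricSpace E] {f : ℕ → E} {x : E}
    (h : ∀ᶠ n in atTop, dist (f n) x < 1 / ((n : ℝ) + 1)) : Tendsto f atTop (𝓝 x) :=
  tendsto_iff_dist_tendsto_zero.2 <| squeeze_zero' (.of_forall fun _ => dist_nonneg)
    (h.mono fun _ hn => hn.le) tendsto_one_div_add_atTop_nhds_zero_nat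

/-- If iterated limits along sequences may be exchanged, then so may iterated limits along arbitrary
filters. -/
theorem iterated_limits_eq {A B E : Type*} [PseudoMetricSpace E] (F : A → B → E)
    (hF : ∀ (a : ℕ → A) (b : ℕ → B) (f g : ℕ → E) (r s : E),
      (∀ k, Tendsto (fun l => F (a k) (b l)) atTop (𝓝 (f k))) → Tendsto f atTop (𝓝 r) →
      (∀ l, Tendsto (fun k => F (a k) (b l)) atTop (𝓝 (g l))) → Tendsto g atTop (𝓝 s) → r = s)
    {la : Filter A} {lb : Filter B} [la.NeBot] [lb.NeBot] {f : A → E} {g : B → E} {r s : E}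
    (hf : ∀ a, Tendsto (F a) lb (𝓝 (f a))) (hr : Tendsto f la (𝓝 r))
    (hg : ∀ b, Tendsto (fun a => F a b) la (𝓝 (g b))) (hs : Tendsto g lb (𝓝 s)) : r = s := by
  -- Each new pair `(a, b)` is tested only against the earlier pairs, never `a` against its own `b`:
  -- an inner limit ignores finitely many indices.
  obtain ⟨t, ht⟩ := exists_seq_of_forall_list_exists (J := A × B)
    (fun l c => (dist (f c.1) r < 1 / ((l.length : ℝ) + 1) ∧
        ∀ d ∈ l, dist (F c.1 d.2) (g d.2) < 1 / ((l.length : ℝ) + 1)) ∧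
      (dist (g c.2) s < 1 / ((l.length : ℝ) + 1) ∧
        ∀ d ∈ l, dist (F d.1 c.2) (f d.1) < 1 / ((l.length : ℝ) + 1))) (by
      intro l
      have hε : 0 < 1 / ((l.length : ℝ) + 1) := Nat.one_div_pos_of_nat
      have ha := (hr.eventually (Metric.ball_mem_nhds r hε)).and
        ((List.finite_toSet l).eventually_all.2 fun d _ =>
          (hg d.2).eventually (Metric.ball_mem_nhds _ hε))
      have hb := (hs.eventually (Metric.ball_mem_nhds s hε)).and
        ((List.finite_toSet l).eventually_all.2 fun d _ =>
          (hf d.1).eventually (Metric.ball_mem_nhds _ hε))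
      obtain ⟨a, ha⟩ := ha.exists
      obtain ⟨b, hb⟩ := hb.exists
      exact ⟨(a, b), ha, hb⟩)
  simp only [List.length_map, List.length_range, List.mem_map, List.mem_range] at ht
  refine hF (fun n => (t n).1) (fun n => (t n).2) (fun n => f (t n).1) (fun n => g (t n).2) r s
    (fun k => ?_) ?_ (fun l => ?_) ?_
  · exact tendsto_of_eventually_dist_lt_one_div <| (eventually_gt_atTop k).mono fun n hn =>
      (ht n).2.2 _ ⟨k, hn, rfl⟩
  · exact tendsto_of_eventually_dist_lt_one_div <| .of_forall fun n => (ht n).1.1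
  · exact tendsto_of_eventually_dist_lt_one_div <| (eventually_gt_atTop l).mono fun n hn =>
      (ht n).1.2 _ ⟨l, hn, rfl⟩
  · exact tendsto_of_eventually_dist_lt_one_div <| .of_forall fun n => (ht n).2.1

theorem comap_nhds_neBot_of_mem_closure_range {B T : Type*} [TopologicalSpace T] {j : B → T} {q : T}
    (hq : q ∈ closure (Set.range j)) : (comap j (𝓝 q)).NeBot := by
  refine comap_neBot fun t ht => ?_
  obtain ⟨_, hx, b, rfl⟩ := mem_closure_iff_nhds.1 hq t ht
  exact ⟨b, hx⟩

/-- By regularity closed neighbourhoods suffice: if `g` stays in a closed `V` near `q`, then its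
limits at all points close to `q` lie in `V` too. -/
theorem continuous_of_tendsto_comap {B T E : Type*} [TopologicalSpace T] [TopologicalSpace E]
    [RegularSpace E] {j : B → T} (hj : DenseRange j) {g : B → E} {G : T → E}
    (h : ∀ q, Tendsto g (comap j (𝓝 q)) (𝓝 (G q))) : Continuous G := by
  refine continuous_iff_continuousAt.2 fun q => ?_
  refine (closed_nhds_basis (G q)).tendsto_right_iff.2 fun V hV => ?_
  obtain ⟨U, hU, hUV⟩ := mem_comap.1 (h q hV.1)
  filter_upwards [eventually_mem_nhds_iff.2 hU] with q' hq'
  have := comap_nhds_neBot_of_mem_closure_range (hj q')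
  exact hV.2.mem_of_tendsto (h q') (mem_of_superset (preimage_mem_comap hq') hUV)

theorem exists_ultrafilter_tendsto_of_mem_closure_range {B T : Type*} [TopologicalSpace T]
    {j : B → T} {q : T} (hq : q ∈ closure (Set.range j)) :
    ∃ l : Ultrafilter B, Tendsto j l (𝓝 q) := by
  have := comap_nhds_neBot_of_mem_closure_range hq
  exact ⟨Ultrafilter.of _, tendsto_iff_comap.2 (Ultrafilter.of_le _)⟩

/-- Grothendieck: a function with the double limit property extends to a separately continuous
function on compactifications. -/
theorem exists_separately_continuous_extension {A B S T E : Type*} [MetricSpace E] [CompactSpace E]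
    [TopologicalSpace S] [TopologicalSpace T] {i : A → S} {j : B → T} (hi : DenseRange i)
    (hj : DenseRange j) (F : A → B → E)
    (hF : ∀ (a : ℕ → A) (b : ℕ → B) (f g : ℕ → E) (r s : E),
      (∀ k, Tendsto (fun l => F (a k) (b l)) atTop (𝓝 (f k))) → Tendsto f atTop (𝓝 r) →
      (∀ l, Tendsto (fun k => F (a k) (b l)) atTop (𝓝 (g l))) → Tendsto g atTop (𝓝 s) → r = s)
    (ev : B → S → E) (ev' : A → T → E) (hev : ∀ b, Continuous (ev b))
    (hev' : ∀ a, Continuous (ev' a)) (hi' : ∀ a b, ev b (i a) = F a b)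
    (hj' : ∀ a b, ev' a (j b) = F a b) :
    ∃ Φ : S → T → E, (∀ p, Continuous (Φ p)) ∧ (∀ q, Continuous fun p => Φ p q) ∧
      (∀ p b, Φ p (j b) = ev b p) ∧ ∀ a q, Φ (i a) q = ev' a q := by
  have key : ∀ (p : S) (q : T) (la : Ultrafilter A) (lb : Ultrafilter B) (r s : E),
      Tendsto i la (𝓝 p) → Tendsto j lb (𝓝 q) → Tendsto (fun b => ev b p) lb (𝓝 s) →
      Tendsto (fun a => ev' a q) la (𝓝 r) → r = s := by
    intro p q la lb r s hp hq hs hr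
    refine iterated_limits_eq F hF (fun a => ?_) hr (fun b => ?_) hs
    · simpa only [Function.comp_def, hj'] using ((hev' a).tendsto q).comp hq
    · simpa only [Function.comp_def, hi'] using ((hev b).tendsto p).comp hp
  choose la hla using fun p => exists_ultrafilter_tendsto_of_mem_closure_range (hi p)
  choose lb hlb using fun q => exists_ultrafilter_tendsto_of_mem_closure_range (hj q)
  -- `Φ p q` is a limit along one chosen ultrafilter; comparing with the other side through `key`
  -- shows that every ultrafilter converging to `p` or to `q` gives the same value.
  have hex : ∀ p q, ∃ r, Tendsto (fun b => ev b p) (lb q) (𝓝 r) := fun p q =>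
    ⟨_, ((lb q).map fun b => ev b p).le_nhds_lim⟩
  choose Φ hΦ using hex
  have hA : ∀ p q (l : Ultrafilter A), Tendsto i l (𝓝 p) →
      Tendsto (fun a => ev' a q) l (𝓝 (Φ p q)) := by
    intro p q l hl
    have hr : Tendsto (fun a => ev' a q) l (𝓝 (l.map fun a => ev' a q).lim) :=
      (l.map fun a => ev' a q).le_nhds_lim
    rwa [key p q l (lb q) _ _ hl (hlb q) (hΦ p q) hr] at hr
  have hB : ∀ p q (l : Ultrafilter B), Tendsto j l (𝓝 q) →
      Tendsto (fun b => ev b p) l (𝓝 (Φ p q)) := by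
    intro p q l hl
    have hr : Tendsto (fun b => ev b p) l (𝓝 (l.map fun b => ev b p).lim) :=
      (l.map fun b => ev b p).le_nhds_lim
    rwa [← key p q (la p) l _ _ (hla p) hl hr (hA p q _ (hla p))] at hr
  refine ⟨Φ, fun p => ?_, fun q => ?_, fun p b => ?_, fun a q => ?_⟩
  · refine continuous_of_tendsto_comap hj (g := fun b => ev b p) fun q => ?_
    exact tendsto_iff_ultrafilter _ _ _ |>.2 fun l hl => hB p q l (tendsto_iff_comap.2 hl)
  · refine continuous_of_tendsto_comap hi (g := fun a => ev' a q) fun p => ?_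
    exact tendsto_iff_ultrafilter _ _ _ |>.2 fun l hl => hA p q l (tendsto_iff_comap.2 hl)
  · exact tendsto_nhds_unique (hB p (j b) (pure b) (tendsto_pure_nhds j b))
      (tendsto_pure_nhds (fun b => ev b p) b)
  · exact tendsto_nhds_unique (hA (i a) q (pure a) (tendsto_pure_nhds i a))
      (tendsto_pure_nhds (fun a => ev' a q) a)

/-- The angelic property of pointwise compact sets of continuous functions on a compact space:
cluster points are limits of sequences, whose choice may be subject to a further condition. -/
theorem exists_seq_tendsto_of_mapClusterPt {S T E J : Type*} [MetricSpace E] [TopologicalSpace S]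
    [CompactSpace S] [TopologicalSpace T] [CompactSpace T] {Φ : S → T → E}
    (hT : ∀ p, Continuous (Φ p)) (hS : ∀ q, Continuous fun p => Φ p q) {l : Filter J} {x : J → S}
    {p : S} (hp : MapClusterPt p l x) (R : J → J → Prop) (hR : ∀ j, ∀ᶠ k in l, R j k) :
    ∃ s : ℕ → J, (∀ n, R (s n) (s (n + 1))) ∧
      ∀ q, Tendsto (fun n => Φ (x (s n)) q) atTop (𝓝 (Φ p q)) := by
  -- Compactness of `T`: up to a tolerance, the finitely many functions `Φ (x k)`, `k ∈ h`, and `Φ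
  -- p` take their values jointly on a finite set.
  have hG : ∀ h : List J, ∃ G : Finset T, ∀ q, ∃ q' ∈ G,
      (∀ k ∈ h, dist (Φ (x k) q) (Φ (x k) q') < 1 / ((h.length : ℝ) + 1)) ∧
        dist (Φ p q) (Φ p q') < 1 / ((h.length : ℝ) + 1) := by
    intro h
    have hε : 0 < 1 / ((h.length : ℝ) + 1) := Nat.one_div_pos_of_nat
    obtain ⟨G, hG⟩ := CompactSpace.elim_nhds_subcover
      (fun q' => {q | (∀ k ∈ h, dist (Φ (x k) q) (Φ (x k) q') < 1 / ((h.length : ℝ) + 1)) ∧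
        dist (Φ p q) (Φ p q') < 1 / ((h.length : ℝ) + 1)})
      (fun q' => ((List.finite_toSet h).eventually_all.2 fun k _ =>
          ((hT (x k)).tendsto q').eventually (Metric.ball_mem_nhds _ hε)).and
        (((hT p).tendsto q').eventually (Metric.ball_mem_nhds _ hε)))
    refine ⟨G, fun q => ?_⟩
    have hq : q ∈ (⊤ : Set T) := trivial
    rw [← hG] at hq
    simpa only [Set.mem_iUnion, Set.mem_ofPred_eq, exists_prop] using hq
  choose G hG using hG
  -- The next term is close to `p` on the finite sets attached to all initial segments of the
  -- history, so that the sequence converges to `Φ p` at each point of each of these sets.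
  obtain ⟨s, hs⟩ := exists_seq_of_forall_list_exists
    (fun h k => (∀ j ∈ h, R j k) ∧ ∀ h' ∈ h.inits, ∀ q ∈ G h',
      dist (Φ (x k) q) (Φ p q) < 1 / ((h.length : ℝ) + 1)) (by
    intro h
    have hε : 0 < 1 / ((h.length : ℝ) + 1) := Nat.one_div_pos_of_nat
    have h1 : ∀ᶠ k in l, ∀ j ∈ h, R j k := (List.finite_toSet h).eventually_all.2 fun j _ => hR j
    have h2 : ∀ᶠ p' in 𝓝 p, ∀ h' ∈ h.inits, ∀ q ∈ G h',
        dist (Φ p' q) (Φ p q) < 1 / ((h.length : ℝ) + 1) :=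
      (List.finite_toSet h.inits).eventually_all.2 fun h' _ =>
        (G h').eventually_all.2 fun q _ =>
          ((hS q).tendsto p).eventually (Metric.ball_mem_nhds _ hε)
    obtain ⟨k, hk2, hk1⟩ := ((hp.frequently h2).and_eventually h1).exists
    exact ⟨k, hk1, hk2⟩)
  simp only [List.length_map, List.length_range, List.mem_map, List.mem_range] at hs
  refine ⟨s, fun n => (hs (n + 1)).1 _ ⟨n, n.lt_succ_self, rfl⟩, fun q => ?_⟩
  -- It suffices that a limit `p'` of the chosen terms along `W` satisfies `Φ p' q = Φ p q`.
  -- Approximate `q` by points `t m` of the finite sets and let `q'` be a limit of these. Then `q`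
  -- and `q'` are indistinguishable for `Φ p` and for every chosen term, hence for `Φ p'`; and `Φ
  -- p'`, `Φ p` agree at each `t m`, hence at `q'`.
  refine tendsto_iff_ultrafilter _ _ _ |>.2 fun W hW => ?_
  let p' := (W.map fun n => x (s n)).lim
  have hp' : Tendsto (fun n => x (s n)) W (𝓝 p') := (W.map fun n => x (s n)).le_nhds_lim
  have hW' : ∀ q, Tendsto (fun n => Φ (x (s n)) q) W (𝓝 (Φ p' q)) := fun q =>
    ((hS q).tendsto p').comp hp'
  choose t ht using fun n => hG ((List.range n).map s) q
  simp only [List.length_map, List.length_range, List.mem_map, List.mem_range] at ht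
  have hp't : ∀ m, Φ p' (t m) = Φ p (t m) := by
    intro m
    refine tendsto_nhds_unique (hW' (t m)) (Tendsto.mono_left ?_ hW)
    refine tendsto_of_eventually_dist_lt_one_div <| (eventually_ge_atTop m).mono fun n hn => ?_
    refine (hs n).2 ((List.range m).map s) ?_ (t m) (ht m).1
    rw [List.mem_inits]
    obtain ⟨d, rfl⟩ := Nat.exists_eq_add_of_le hn
    rw [List.range_add, List.map_append]
    exact List.prefix_append _ _
  let V : Ultrafilter ℕ := hyperfilter ℕ
  have hV : (V : Filter ℕ) ≤ atTop := Nat.hyperfilter_le_atTop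
  let q' := (V.map t).lim
  have hq' : Tendsto t V (𝓝 q') := (V.map t).le_nhds_lim
  have e1 : Φ p q' = Φ p q := by
    refine tendsto_nhds_unique (((hT p).tendsto q').comp hq') (Tendsto.mono_left ?_ hV)
    refine tendsto_of_eventually_dist_lt_one_div <| .of_forall fun n => ?_
    rw [dist_comm]
    exact (ht n).2.2
  have e2 : ∀ k, Φ (x (s k)) q' = Φ (x (s k)) q := by
    intro k
    refine tendsto_nhds_unique (((hT _).tendsto q').comp hq') (Tendsto.mono_left ?_ hV)
    refine tendsto_of_eventually_dist_lt_one_div <| (eventually_gt_atTop k).mono fun n hn => ?_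
    rw [dist_comm]
    exact (ht n).2.1 _ ⟨k, hn, rfl⟩
  have e3 : Φ p' q' = Φ p q' := by
    refine tendsto_nhds_unique (((hT p').tendsto q').comp hq') ?_
    simpa only [Function.comp_def, hp't] using ((hT p).tendsto q').comp hq'
  have e4 : Φ p' q' = Φ p' q := tendsto_nhds_unique (hW' q') (by simpa only [e2] using hW' q)
  rw [← e1, ← e3, e4]
  exact hW' q

end Topology
-- Riesz representation and weak convergence
section Functionals

open MeasureTheory
open scoped NNReal CompactlySupported

variable {T : Type*} [TopologicalSpace T]

/-- The values of a functional on the functions which are bounded in absolute value by `f`. -/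
def boundedValues (Λ : (T →ᵇ ℝ) →L[ℝ] ℝ) (f : T → ℝ≥0) : Set ℝ :=
  Λ '' {g | ∀ x, |g x| ≤ f x}

theorem boundedValues_nonempty (Λ : (T →ᵇ ℝ) →L[ℝ] ℝ) (f : T → ℝ≥0) :
    (boundedValues Λ f).Nonempty :=
  ⟨Λ 0, 0, by simp, rfl⟩

theorem zero_mem_boundedValues (Λ : (T →ᵇ ℝ) →L[ℝ] ℝ) (f : T → ℝ≥0) : 0 ∈ boundedValues Λ f :=
  ⟨0, by simp, map_zero Λ⟩

open scoped Pointwise in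
theorem boundedValues_add [CompactSpace T] (Λ : (T →ᵇ ℝ) →L[ℝ] ℝ) {f₁ f₂ : T → ℝ≥0}
    (h₁ : Continuous f₁) :
    boundedValues Λ (f₁ + f₂) = boundedValues Λ f₁ + boundedValues Λ f₂ := by
  ext r
  simp only [Set.mem_add]
  constructor
  · rintro ⟨g, hg, rfl⟩
    let F : T →ᵇ ℝ := BoundedContinuousFunction.mkOfCompact
      ⟨fun x => (f₁ x : ℝ), NNReal.continuous_coe.comp h₁⟩
    -- Riesz decomposition: truncate `g` to `[-f₁, f₁]`; the remainder is bounded by `f₂`.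
    let g₁ : T →ᵇ ℝ := (-F) ⊔ (F ⊓ g)
    have hg₁ : ∀ x, g₁ x = max (-(f₁ x : ℝ)) (min (f₁ x) (g x)) := fun x => rfl
    refine ⟨_, ⟨g₁, fun x => ?_, rfl⟩, _, ⟨g - g₁, fun x => ?_, rfl⟩, ?_⟩
    · rw [hg₁, abs_le]
      exact ⟨le_max_left _ _, max_le (by linarith [(f₁ x).2, (f₁ x).coe_nonneg]) (min_le_left _ _)⟩
    · have := hg x
      simp only [Pi.add_apply, NNReal.coe_add, abs_le] at this
      rw [BoundedContinuousFunction.sub_apply, hg₁, abs_le]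
      have h1 := (f₁ x).coe_nonneg
      have h2 := (f₂ x).coe_nonneg
      constructor
      · rcases max_cases (-(f₁ x : ℝ)) (min (f₁ x) (g x)) with h | h <;>
        rcases min_cases (f₁ x : ℝ) (g x) with h' | h' <;> linarith
      · rcases max_cases (-(f₁ x : ℝ)) (min (f₁ x) (g x)) with h | h <;>
        rcases min_cases (f₁ x : ℝ) (g x) with h' | h' <;> linarith
    · rw [map_sub]
      ring
  · rintro ⟨_, ⟨g₁, h1, rfl⟩, _, ⟨g₂, h2, rfl⟩, rfl⟩
    exact ⟨g₁ + g₂, fun x => (abs_add_le _ _).trans (add_le_add (h1 x) (h2 x)), map_add Λ _ _⟩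

open scoped Pointwise in
theorem boundedValues_smul (Λ : (T →ᵇ ℝ) →L[ℝ] ℝ) (c : ℝ≥0) (f : T → ℝ≥0) :
    boundedValues Λ (c • f) = (c : ℝ) • boundedValues Λ f := by
  rcases eq_or_ne c 0 with rfl | hc
  · rw [NNReal.coe_zero, Set.zero_smul_set (boundedValues_nonempty Λ f)]
    ext r
    constructor
    · rintro ⟨g, hg, rfl⟩
      have : g = 0 := by
        ext x
        simpa using hg x
      simp [this]
    · rintro rfl
      exact zero_mem_boundedValues _ _
  · have hc' : 0 < (c : ℝ) := by positivity
    ext r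
    rw [Set.mem_smul_set]
    constructor
    · rintro ⟨g, hg, rfl⟩
      refine ⟨_, ⟨(c : ℝ)⁻¹ • g, fun x => ?_, rfl⟩, ?_⟩
      · have := hg x
        simp only [Pi.smul_apply, smul_eq_mul, NNReal.coe_mul] at this
        rw [BoundedContinuousFunction.smul_apply, smul_eq_mul, abs_mul, abs_inv, abs_of_pos hc']
        exact (inv_mul_le_iff₀ hc').2 this
      · rw [map_smul, smul_smul, mul_inv_cancel₀ hc'.ne', one_smul]
    · rintro ⟨_, ⟨g, hg, rfl⟩, rfl⟩
      refine ⟨(c : ℝ) • g, fun x => ?_, map_smul Λ _ _⟩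
      rw [BoundedContinuousFunction.smul_apply, smul_eq_mul, abs_mul, abs_of_pos hc']
      simpa using mul_le_mul_of_nonneg_left (hg x) hc'.le

variable [CompactSpace T]

theorem bddAbove_boundedValues (Λ : (T →ᵇ ℝ) →L[ℝ] ℝ) {f : T → ℝ≥0} (hf : Continuous f) :
    BddAbove (boundedValues Λ f) := by
  obtain ⟨C, hC⟩ := (isCompact_range hf).bddAbove
  refine ⟨‖Λ‖ * C, ?_⟩
  rintro _ ⟨g, hg, rfl⟩
  refine (le_abs_self _).trans ((Λ.le_opNorm g).trans ?_)
  gcongr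
  refine (BoundedContinuousFunction.norm_le C.2).2 fun x => (hg x).trans ?_
  exact_mod_cast hC ⟨x, rfl⟩

/-- The total variation of a functional, as a positive functional. -/
noncomputable def variationFunctional (Λ : (T →ᵇ ℝ) →L[ℝ] ℝ) : C_c(T, ℝ≥0) →ₗ[ℝ≥0] ℝ≥0 where
  toFun f := ⟨sSup (boundedValues Λ f),
    le_csSup (bddAbove_boundedValues Λ f.continuous) (zero_mem_boundedValues Λ f)⟩
  map_add' f g := by
    refine NNReal.eq (?_ : sSup (boundedValues Λ (f + g : T → ℝ≥0)) =
      sSup (boundedValues Λ f) + sSup (boundedValues Λ g))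
    rw [boundedValues_add Λ (f₁ := ⇑f) f.continuous]
    exact csSup_add (boundedValues_nonempty _ _) (bddAbove_boundedValues Λ f.continuous)
      (boundedValues_nonempty _ _) (bddAbove_boundedValues Λ g.continuous)
  map_smul' c f := by
    refine NNReal.eq (?_ : sSup (boundedValues Λ (c • (f : T → ℝ≥0))) =
      (c : ℝ) * sSup (boundedValues Λ f))
    rw [boundedValues_smul Λ, Real.sSup_smul_of_nonneg c.coe_nonneg, smul_eq_mul]

/-- Every bounded functional on a space of continuous functions on a compact Hausdorff space is
dominated by a finite measure. -/
theorem exists_finite_measure_dominating [T2Space T] [MeasurableSpace T] [BorelSpace T]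
    (Λ : (T →ᵇ ℝ) →L[ℝ] ℝ) :
    ∃ μ : Measure T, IsFiniteMeasure μ ∧ ∀ f : T →ᵇ ℝ, |Λ f| ≤ ∫ x, |f x| ∂μ := by
  refine ⟨NNRealRMK.rieszMeasure (variationFunctional Λ), ?_, fun f => ?_⟩
  · infer_instance
  · let F : C_c(T, ℝ≥0) := CompactlySupportedContinuousMap.continuousMapEquiv
      ⟨fun x => ‖f x‖₊, by fun_prop⟩
    have hF : ∀ x, ((F x : ℝ≥0) : ℝ) = |f x| := fun x => rfl
    have h := NNRealRMK.integral_rieszMeasure (variationFunctional Λ) F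
    simp only [hF] at h
    rw [h]
    have hb := bddAbove_boundedValues Λ F.continuous
    refine abs_le'.2 ⟨le_csSup hb ⟨f, fun x => (hF x).ge, rfl⟩, le_csSup hb ⟨-f, fun x => ?_, ?_⟩⟩
    · rw [BoundedContinuousFunction.neg_apply, abs_neg, hF]
    · exact map_neg Λ f

/-- `|Λ (f n - g)|` is at most the integral of `|f n - g|` against a finite measure, which tends to
zero by dominated convergence. -/
theorem tendsto_functional_of_pointwise_real [T2Space T] (Λ : (T →ᵇ ℝ) →L[ℝ] ℝ) {f : ℕ → T →ᵇ ℝ}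
    {g : T →ᵇ ℝ} {C : ℝ} (hC : ∀ n x, |f n x| ≤ C)
    (h : ∀ x, Tendsto (fun n => f n x) atTop (𝓝 (g x))) :
    Tendsto (fun n => Λ (f n)) atTop (𝓝 (Λ g)) := by
  borelize T
  obtain ⟨μ, _, hμ⟩ := exists_finite_measure_dominating Λ
  have hlim : Tendsto (fun n => ∫ x, |(f n - g) x| ∂μ) atTop (𝓝 (∫ _, (0 : ℝ) ∂μ)) := by
    refine tendsto_integral_of_dominated_convergence (fun _ => C + ‖g‖) (fun n => ?_)
      (integrable_const _) (fun n => .of_forall fun x => ?_) (.of_forall fun x => ?_)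
    · exact ((f n - g).continuous.abs).aestronglyMeasurable
    · rw [Real.norm_eq_abs, abs_abs, BoundedContinuousFunction.sub_apply]
      exact (abs_sub _ _).trans (add_le_add (hC n x) (g.norm_coe_le_norm x))
    · simpa using ((h x).sub_const (g x)).abs
  rw [integral_zero] at hlim
  refine tendsto_iff_dist_tendsto_zero.2 (squeeze_zero (fun _ => dist_nonneg) (fun n => ?_) hlim)
  rw [Real.dist_eq, ← map_sub]
  exact hμ _

/-- On a compact space, bounded pointwise convergence of real functions implies their weak
convergence in the space of continuous complex functions. -/
theorem tendsto_functional_of_pointwise [T2Space T] (Λ : (T →ᵇ ℂ) →L[ℂ] ℂ) {f : ℕ → T →ᵇ ℝ}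
    {g : T →ᵇ ℝ} {C : ℝ} (hC : ∀ n x, |f n x| ≤ C)
    (h : ∀ x, Tendsto (fun n => f n x) atTop (𝓝 (g x))) :
    Tendsto (fun n => Λ (Complex.ofRealCLM.compLeftContinuousBounded T (f n))) atTop
      (𝓝 (Λ (Complex.ofRealCLM.compLeftContinuousBounded T g))) := by
  let Λ' : (T →ᵇ ℝ) →L[ℝ] ℂ :=
    (Λ.restrictScalars ℝ).comp (Complex.ofRealCLM.compLeftContinuousBounded T)
  have hre := tendsto_functional_of_pointwise_real (Complex.reCLM.comp Λ') hC h
  have him := tendsto_functional_of_pointwise_real (Complex.imCLM.comp Λ') hC h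
  have := (hre.ofReal).add ((him.ofReal).mul_const Complex.I)
  simpa [Λ', Complex.re_add_im] using this

end Functionals
-- Metric ultrapowers and Łoś's theorem
section Ultrapower

variable (L : Language.{u, v}) (M : Type w) [MetricSpace M] [Structure L M] {ι : Type w}
  (U : Ultrafilter ι)

theorem tendsto_lim_map {X : Type*} [TopologicalSpace X] [CompactSpace X] {ι : Type*}
    (U : Ultrafilter ι) (h : ι → X) : Tendsto h U (𝓝 (U.map h).lim) :=
  (U.map h).le_nhds_lim

/-- The distance as an element of the unit interval. -/
def unitDist (x y : M) : I :=
  ⟨dist x y, dist_nonneg, Structure.dist_le_one L x y⟩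

/-- Families of elements of `M`, with the pseudo-distance given by the limit along an
ultrafilter. -/
@[nolint unusedArguments]
def UltraFamily (L : Language.{u, v}) (M : Type w) [MetricSpace M] [Structure L M] {ι : Type w}
    (_ : Ultrafilter ι) : Type w :=
  ι → M

noncomputable instance : Dist (UltraFamily L M U) :=
  ⟨fun f g => (U.map fun i => unitDist L M (f i) (g i)).lim⟩

variable {L M U} in
theorem UltraFamily.tendsto_dist (f g : UltraFamily L M U) :
    Tendsto (fun i => dist (f i) (g i)) U (𝓝 (dist f g)) :=
  (continuous_subtype_val.tendsto _).comp
    (tendsto_lim_map U fun i => unitDist L M (f i) (g i))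

noncomputable instance : PseudoMetricSpace (UltraFamily L M U) where
  dist_self f := tendsto_nhds_unique (UltraFamily.tendsto_dist f f) (by simp)
  dist_comm f g := tendsto_nhds_unique (UltraFamily.tendsto_dist f g)
    (by simpa only [dist_comm] using UltraFamily.tendsto_dist g f)
  dist_triangle f g h := le_of_tendsto_of_tendsto' (UltraFamily.tendsto_dist f h)
    ((UltraFamily.tendsto_dist f g).add (UltraFamily.tendsto_dist g h))
    fun _ => dist_triangle _ _ _

/-- The metric ultrapower of a structure. -/
abbrev Ultrapower : Type w :=
  SeparationQuotient (UltraFamily L M U)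

/-- The class in the ultrapower of a family of elements. -/
noncomputable def Ultrapower.mk (f : ι → M) : Ultrapower L M U :=
  SeparationQuotient.mk (X := UltraFamily L M U) f

variable {L M U}

theorem Ultrapower.exists_rep (x : Ultrapower L M U) : ∃ f, Ultrapower.mk L M U f = x :=
  SeparationQuotient.surjective_mk x

/-- A family which represents an element of the ultrapower. -/
noncomputable def Ultrapower.rep (x : Ultrapower L M U) : ι → M :=
  x.exists_rep.choose

@[simp]
theorem Ultrapower.mk_rep (x : Ultrapower L M U) : Ultrapower.mk L M U x.rep = x :=
  x.exists_rep.choose_spec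

theorem Ultrapower.tendsto_dist (f g : ι → M) :
    Tendsto (fun i => dist (f i) (g i)) U
      (𝓝 (dist (Ultrapower.mk L M U f) (Ultrapower.mk L M U g))) :=
  UltraFamily.tendsto_dist (L := L) (M := M) (U := U) f g

/-- A strict bound on the limit distances holds on a large set of indices, and the non-strict
conclusion survives the limit. This yields both the modulus in the ultrapower and independence of
representatives. -/
theorem Ultrapower.dist_mk_funMap_le {n : ℕ} (F : L.Functions n) {ε : ℝ} (hε : 0 < ε)
    (x y : Fin n → ι → M)
    (h : ∀ j, dist (Ultrapower.mk L M U (x j)) (Ultrapower.mk L M U (y j)) < L.funModulus F ε) :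
    dist (Ultrapower.mk L M U fun i => Structure.funMap F fun j => x j i)
      (Ultrapower.mk L M U fun i => Structure.funMap F fun j => y j i) ≤ ε := by
  refine le_of_tendsto (Ultrapower.tendsto_dist _ _) ?_
  filter_upwards [eventually_all.2 fun j =>
    (Ultrapower.tendsto_dist (x j) (y j)).eventually_lt_const (h j)] with i hi
  exact Structure.funMap_modulus F ε hε _ _ hi

/-- The limit along the ultrafilter of the values of a predicate symbol. -/
noncomputable def Ultrapower.relLim (U : Ultrafilter ι) {n : ℕ} (R : L.Relations n)
    (x : Fin n → ι → M) : I :=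
  (U.map fun i => Structure.relMap R fun j => x j i).lim

theorem Ultrapower.tendsto_relLim {n : ℕ} (R : L.Relations n) (x : Fin n → ι → M) :
    Tendsto (fun i => Structure.relMap R fun j => x j i) U (𝓝 (Ultrapower.relLim U R x)) :=
  tendsto_lim_map U _

theorem Ultrapower.dist_relLim_le {n : ℕ} (R : L.Relations n) {ε : ℝ} (hε : 0 < ε)
    (x y : Fin n → ι → M)
    (h : ∀ j, dist (Ultrapower.mk L M U (x j)) (Ultrapower.mk L M U (y j)) < L.relModulus R ε) :
    dist (Ultrapower.relLim U R x) (Ultrapower.relLim U R y) ≤ ε := by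
  refine le_of_tendsto ((Ultrapower.tendsto_relLim R x).dist (Ultrapower.tendsto_relLim R y)) ?_
  filter_upwards [eventually_all.2 fun j =>
    (Ultrapower.tendsto_dist (x j) (y j)).eventually_lt_const (h j)] with i hi
  exact Structure.relMap_modulus R ε hε _ _ hi

/-- Take a rapidly Cauchy sequence of classes. Its next representative is replaced by the previous
one at indices where the two are too far apart; these form a null set, so the class is unchanged.
Now every coordinate is a Cauchy sequence, and the coordinatewise limits represent the limit. -/
instance : CompleteSpace (Ultrapower L M U) := by
  have := Structure.nonempty L (M := M)
  have := Structure.complete L (M := M)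
  refine Metric.complete_of_convergent_controlled_sequences (fun n => (1 / 2 : ℝ) ^ n)
    (by simp) fun c hc => ?_
  -- representatives which are uniformly Cauchy
  let r : ℕ → ι → M := fun n => Nat.rec (c 0).rep
    (fun n f i => open scoped Classical in
      if dist (f i) ((c (n + 1)).rep i) < (1 / 2) ^ n then (c (n + 1)).rep i else f i) n
  have hr : ∀ n i, r (n + 1) i = open scoped Classical in
      if dist (r n i) ((c (n + 1)).rep i) < (1 / 2) ^ n then (c (n + 1)).rep i else r n i :=
    fun n i => rfl
  have hstep : ∀ i n, dist (r n i) (r (n + 1) i) ≤ 2 / 2 / 2 ^ n := by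
    intro i n
    have h2 : (1 / 2 : ℝ) ^ n = 2 / 2 / 2 ^ n := by rw [one_div, inv_pow]; ring
    rw [← h2, hr]
    split_ifs with h
    · exact h.le
    · simp
  have hmk : ∀ n, Ultrapower.mk L M U (r n) = c n := by
    intro n
    induction n with
    | zero => exact (c 0).mk_rep
    | succ n ih =>
      rw [← (c (n + 1)).mk_rep]
      have hd : dist (Ultrapower.mk L M U (r n)) (Ultrapower.mk L M U (c (n + 1)).rep) <
          (1 / 2) ^ n := by
        rw [ih, Ultrapower.mk_rep]
        exact hc n n (n + 1) le_rfl n.le_succ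
      refine dist_eq_zero.1 (tendsto_nhds_unique (Ultrapower.tendsto_dist _ _) ?_)
      refine tendsto_const_nhds.congr' ?_
      filter_upwards [(Ultrapower.tendsto_dist _ _).eventually_lt_const hd] with i hi
      rw [hr, if_pos hi, dist_self]
  choose y hy using fun i => cauchySeq_tendsto_of_complete
    (cauchySeq_of_le_geometric_two (hstep i))
  refine ⟨Ultrapower.mk L M U y, ?_⟩
  have hlim : Tendsto (fun n : ℕ => (2 : ℝ) / 2 ^ n) atTop (𝓝 0) := by
    simpa [div_eq_mul_inv] using
      (tendsto_pow_atTop_nhds_zero_of_lt_one (r := (2 : ℝ)⁻¹) (by norm_num)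
        (by norm_num)).const_mul 2
  refine tendsto_iff_dist_tendsto_zero.2 (squeeze_zero (fun _ => dist_nonneg) (fun n => ?_) hlim)
  rw [← hmk n]
  exact le_of_tendsto (Ultrapower.tendsto_dist _ _) (.of_forall fun i =>
    dist_le_of_le_geometric_two_of_tendsto (hstep i) (hy i) n)

noncomputable instance : Structure L (Ultrapower L M U) where
  nonempty := by
    obtain ⟨a⟩ := Structure.nonempty L (M := M)
    exact ⟨Ultrapower.mk L M U fun _ => a⟩
  complete := inferInstance
  dist_le_one x y := by
    rw [← x.mk_rep, ← y.mk_rep]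
    exact le_of_tendsto (Ultrapower.tendsto_dist _ _)
      (.of_forall fun i => Structure.dist_le_one L _ _)
  funMap F x := Ultrapower.mk L M U fun i => Structure.funMap F fun j => (x j).rep i
  relMap R x := Ultrapower.relLim U R fun j => (x j).rep
  funMap_modulus F ε hε x y h := Ultrapower.dist_mk_funMap_le F hε _ _ (by simpa using h)
  relMap_modulus R ε hε x y h := Ultrapower.dist_relLim_le R hε _ _ (by simpa using h)

theorem Ultrapower.funMap_mk {n : ℕ} (F : L.Functions n) (x : Fin n → ι → M) :
    Structure.funMap F (fun j => Ultrapower.mk L M U (x j)) =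
      Ultrapower.mk L M U fun i => Structure.funMap F fun j => x j i := by
  refine dist_le_zero.1 (le_of_forall_pos_le_add fun ε hε => ?_)
  rw [zero_add]
  refine Ultrapower.dist_mk_funMap_le F hε _ _ fun j => ?_
  rw [Ultrapower.mk_rep, dist_self]
  exact L.funModulus_pos F ε hε

theorem Ultrapower.relMap_mk {n : ℕ} (R : L.Relations n) (x : Fin n → ι → M) :
    Structure.relMap R (fun j => Ultrapower.mk L M U (x j)) = Ultrapower.relLim U R x := by
  refine dist_le_zero.1 (le_of_forall_pos_le_add fun ε hε => ?_)
  rw [zero_add]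
  refine Ultrapower.dist_relLim_le R hε _ _ fun j => ?_
  rw [Ultrapower.mk_rep, dist_self]
  exact L.relModulus_pos R ε hε

theorem Ultrapower.termValue_mk {α : Type} (x : α → ι → M) (t : L.toLanguage.Term α) :
    termValue (L := L) (fun a => Ultrapower.mk L M U (x a)) t =
      Ultrapower.mk L M U fun i => termValue (L := L) (fun a => x a i) t := by
  induction t with
  | var a => rfl
  | func F ts ih =>
    simp only [termValue, ih]
    exact Ultrapower.funMap_mk F _

/-- Łoś's theorem. -/
theorem Ultrapower.tendsto_value {α : Type} {n : ℕ} (φ : BoundedFormula L α n) (x : α → ι → M)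
    (z : Fin n → ι → M) :
    Tendsto (fun i => φ.value (fun a => x a i) fun j => z j i) U
      (𝓝 (φ.value (fun a => Ultrapower.mk L M U (x a)) fun j => Ultrapower.mk L M U (z j))) := by
  have elim : ∀ {n : ℕ} (z : Fin n → ι → M),
      Sum.elim (fun a => Ultrapower.mk L M U (x a)) (fun j => Ultrapower.mk L M U (z j)) =
        fun a => Ultrapower.mk L M U (Sum.elim x z a) := by
    intro n z
    funext a
    cases a <;> rfl
  have elim' : ∀ {n : ℕ} (z : Fin n → ι → M) (i : ι),
      (Sum.elim (fun a => x a i) fun j => z j i) = fun a => Sum.elim x z a i := by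
    intro n z i
    funext a
    cases a <;> rfl
  have snoc : ∀ {n : ℕ} (z : Fin n → ι → M) (c : ι → M),
      (Fin.snoc (fun j => Ultrapower.mk L M U (z j)) (Ultrapower.mk L M U c) :
        Fin (n + 1) → Ultrapower L M U) =
        fun j => Ultrapower.mk L M U ((Fin.snoc z c : Fin (n + 1) → ι → M) j) := by
    intro n z c
    funext j
    refine Fin.lastCases ?_ (fun j => ?_) j <;> simp
  have snoc' : ∀ {n : ℕ} (z : Fin n → ι → M) (c : ι → M) (i : ι),
      (Fin.snoc (fun j => z j i) (c i) : Fin (n + 1) → M) =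
        fun j => (Fin.snoc z c : Fin (n + 1) → ι → M) j i := by
    intro n z c i
    funext j
    refine Fin.lastCases ?_ (fun j => ?_) j <;> simp
  induction φ with
  | rel R ts =>
    simp only [BoundedFormula.value, elim, elim', Ultrapower.termValue_mk, Ultrapower.relMap_mk]
    exact Ultrapower.tendsto_relLim R _
  | dist t₁ t₂ =>
    simp only [BoundedFormula.value, elim, elim', Ultrapower.termValue_mk]
    exact tendsto_subtype_rng.2 (Ultrapower.tendsto_dist _ _)
  | conn c φs ih =>
    exact (c.continuous.tendsto _).comp (tendsto_pi_nhds.2 fun k => ih k z)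
  | sup φ ih =>
    have := Structure.nonempty L (M := M)
    have ih' : ∀ c : ι → M, _ := fun c => ih (Fin.snoc z c)
    simp only [← snoc, ← snoc'] at ih'
    simp only [BoundedFormula.value]
    refine tendsto_order.2 ⟨fun t ht => ?_, fun t ht => ?_⟩
    · obtain ⟨c, hc⟩ := lt_iSup_iff.1 ht
      rw [← c.mk_rep] at hc
      filter_upwards [(ih' _).eventually_const_lt hc] with i hi
      exact hi.trans_le (le_iSup (fun a => φ.value (fun a => x a i) (Fin.snoc (fun j => z j i) a)) _)
    -- If the suprema were at least `t` on a large set, near-optimal witnesses there would form an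
    -- element of the ultrapower with value at least `t'`, above the supremum. Elsewhere the witness
    -- is arbitrary.
    · obtain ⟨t', ht', ht't⟩ := exists_between ht
      by_contra hcon
      rw [← Ultrafilter.eventually_not] at hcon
      choose c hc using fun i => show ∃ a : M,
          ¬ (⨆ a : M, φ.value (fun a => x a i) (Fin.snoc (fun j => z j i) a)) < t →
            t' < φ.value (fun a => x a i) (Fin.snoc (fun j => z j i) a) by
        by_cases h : (⨆ a : M, φ.value (fun a => x a i) (Fin.snoc (fun j => z j i) a)) < t
        · exact ⟨Classical.arbitrary M, fun h' => absurd h h'⟩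
        · obtain ⟨a, ha⟩ := lt_iSup_iff.1 (ht't.trans_le (not_lt.1 h))
          exact ⟨a, fun _ => ha⟩
      exact (ht'.trans_le (ge_of_tendsto (ih' c) (hcon.mono fun i hi => (hc i hi).le))).not_ge
        (le_iSup (fun a => φ.value (fun a => Ultrapower.mk L M U (x a))
          (Fin.snoc (fun j => Ultrapower.mk L M U (z j)) a)) _)
  | inf φ ih =>
    have := Structure.nonempty L (M := M)
    have ih' : ∀ c : ι → M, _ := fun c => ih (Fin.snoc z c)
    simp only [← snoc, ← snoc'] at ih'
    simp only [BoundedFormula.value]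
    refine tendsto_order.2 ⟨fun t ht => ?_, fun t ht => ?_⟩
    · obtain ⟨t', ht't, ht'⟩ := exists_between ht
      by_contra hcon
      rw [← Ultrafilter.eventually_not] at hcon
      choose c hc using fun i => show ∃ a : M,
          ¬ t < (⨅ a : M, φ.value (fun a => x a i) (Fin.snoc (fun j => z j i) a)) →
            φ.value (fun a => x a i) (Fin.snoc (fun j => z j i) a) < t' by
        by_cases h : t < ⨅ a : M, φ.value (fun a => x a i) (Fin.snoc (fun j => z j i) a)
        · exact ⟨Classical.arbitrary M, fun h' => absurd h h'⟩
        · obtain ⟨a, ha⟩ := iInf_lt_iff.1 ((not_lt.1 h).trans_lt ht't)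
          exact ⟨a, fun _ => ha⟩
      exact ((le_of_tendsto (ih' c) (hcon.mono fun i hi => (hc i hi).le)).trans_lt ht').not_ge
        (iInf_le (fun a => φ.value (fun a => Ultrapower.mk L M U (x a))
          (Fin.snoc (fun j => Ultrapower.mk L M U (z j)) a)) _)
    · obtain ⟨c, hc⟩ := iInf_lt_iff.1 ht
      rw [← c.mk_rep] at hc
      filter_upwards [(ih' _).eventually_lt_const hc] with i hi
      exact (iInf_le (fun a => φ.value (fun a => x a i) (Fin.snoc (fun j => z j i) a)) _).trans_lt hi

theorem Ultrapower.tendsto_eval {α : Type} (φ : Formula L α) (x : α → ι → M) :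
    Tendsto (fun i => φ.eval fun a => x a i) U
      (𝓝 (φ.eval fun a => Ultrapower.mk L M U (x a))) := by
  unfold Formula.eval
  convert Ultrapower.tendsto_value (U := U) φ x Fin.elim0 using 2
  · congr 1
    exact Subsingleton.elim _ _
  · congr 1
    exact Subsingleton.elim _ _

variable (L M U) in
/-- The diagonal embedding of a structure in an ultrapower. -/
noncomputable def Ultrapower.diagonal : ElementaryEmbedding L M (Ultrapower L M U) where
  toFun a := Ultrapower.mk L M U fun _ => a
  map_formula _ ψ x := tendsto_nhds_unique
    (Ultrapower.tendsto_eval (U := U) ψ fun j _ => x j) tendsto_const_nhds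

end Ultrapower

/-! ### Types as the closure of the realised types -/

section Compactness

variable {L : Language.{u, v}} {M : Type w} [MetricSpace M] [Structure L M] {m n : ℕ}

/-- Pointwise limits of realised types are types. -/
theorem isPhiType_of_tendsto {φ : Formula L (Fin m ⊕ Fin n)} {U : Ultrafilter (Fin m → M)}
    {p : (Fin n → M) → I} (h : Tendsto (fun a b => φ.eval₂ a b) U (𝓝 p)) : IsPhiType φ M p := by
  -- The ultrapower is indexed by the tuples themselves, and the type is realised by the class of
  -- the identity family.
  refine ⟨Ultrapower L M U, inferInstance, inferInstance, Ultrapower.diagonal L M U,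
    fun j => Ultrapower.mk L M U fun a => a j, fun b => ?_⟩
  refine tendsto_nhds_unique (tendsto_pi_nhds.1 h b) ?_
  have := Ultrapower.tendsto_eval (U := U) φ (Sum.elim (fun j a => a j) fun j _ => b j)
  unfold Formula.eval₂
  convert this using 2
  · congr 1
    funext a
    cases a <;> rfl
  · congr 1
    funext a
    cases a <;> rfl

/-- The assignment of bound variables obtained by moving some free variables among them. -/
def shiftVar {α β : Type} (g : α → β ⊕ Fin m) (k : ℕ) : α ⊕ Fin k → β ⊕ Fin (m + k) :=
  Sum.elim (fun a => Sum.map id (Fin.castAdd k) (g a)) fun i => .inr (Fin.natAdd m i)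

/-- Turn some of the free variables of a formula into variables available for quantification. -/
def BoundedFormula.shift {α β : Type} (g : α → β ⊕ Fin m) :
    {k : ℕ} → BoundedFormula L α k → BoundedFormula L β (m + k)
  | k, .rel R ts => .rel R fun i => (ts i).relabel (shiftVar g k)
  | k, .dist t₁ t₂ => .dist (t₁.relabel (shiftVar g k)) (t₂.relabel (shiftVar g k))
  | _, .conn c φs => .conn c fun i => (φs i).shift g
  | _, .sup φ => .sup (φ.shift g)
  | _, .inf φ => .inf (φ.shift g)

theorem BoundedFormula.value_shift {α β : Type} (g : α → β ⊕ Fin m) (x : β → M) {k : ℕ}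
    (φ : BoundedFormula L α k) (z : Fin (m + k) → M) :
    (φ.shift g).value x z =
      φ.value (Sum.elim x (z ∘ Fin.castAdd k) ∘ g) (z ∘ Fin.natAdd m) := by
  have key : ∀ {k : ℕ} (z : Fin (m + k) → M), Sum.elim x z ∘ shiftVar g k =
      Sum.elim (Sum.elim x (z ∘ Fin.castAdd k) ∘ g) (z ∘ Fin.natAdd m) := by
    intro k z
    funext i
    rcases i with a | i
    · simp only [shiftVar, Function.comp_apply, Sum.elim_inl]
      cases g a <;> rfl
    · rfl
  induction φ with
  | rel R ts => simp only [BoundedFormula.shift, BoundedFormula.value, termValue_relabel, key]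
  | dist t₁ t₂ => simp only [BoundedFormula.shift, BoundedFormula.value, termValue_relabel, key]
  | conn c φs ih => simp only [BoundedFormula.shift, BoundedFormula.value, ih]
  | sup φ ih =>
    simp only [BoundedFormula.shift, BoundedFormula.value]
    refine iSup_congr fun a => ?_
    rw [← Fin.snoc_comp_natAdd, ← Fin.snoc_comp_castAdd (a := a)]
    exact ih _
  | inf φ ih =>
    simp only [BoundedFormula.shift, BoundedFormula.value]
    refine iInf_congr fun a => ?_
    rw [← Fin.snoc_comp_natAdd, ← Fin.snoc_comp_castAdd (a := a)]
    exact ih _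

/-- Close a formula by infima over all the variables available for quantification. -/
def BoundedFormula.infs {β : Type} : {k : ℕ} → BoundedFormula L β k → Formula L β
  | 0, φ => φ
  | _ + 1, φ => (BoundedFormula.inf φ).infs

/-- The inequality is strict, so an infimum below `t` has an actual witness even when it is not
attained. -/
theorem BoundedFormula.eval_infs_lt_iff {β : Type} (x : β → M) {k : ℕ} (φ : BoundedFormula L β k)
    (t : I) : φ.infs.eval x < t ↔ ∃ z : Fin k → M, φ.value x z < t := by
  induction k with
  | zero =>
    refine ⟨fun h => ⟨Fin.elim0, h⟩, fun ⟨z, hz⟩ => ?_⟩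
    rwa [Subsingleton.elim z Fin.elim0] at hz
  | succ k ih =>
    rw [BoundedFormula.infs, ih]
    simp only [BoundedFormula.value, iInf_lt_iff]
    refine ⟨fun ⟨z, a, h⟩ => ⟨_, h⟩, fun ⟨z, h⟩ => ⟨Fin.init z, z (Fin.last k), ?_⟩⟩
    rwa [Fin.snoc_init_self]

theorem ElementaryEmbedding.eval_map {N : Type w} [MetricSpace N] [Structure L N]
    (e : ElementaryEmbedding L M N) {α : Type} [Finite α] (ψ : Formula L α) (x : α → M) :
    ψ.eval (e.toFun ∘ x) = ψ.eval x := by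
  obtain ⟨k, ⟨f⟩⟩ := Finite.exists_equiv_fin α
  have h : ∀ {K : Type w} [MetricSpace K] [Structure L K] (y : α → K),
      Formula.eval (BoundedFormula.relabel f ψ) (y ∘ f.symm) = ψ.eval y := by
    intro K _ _ y
    unfold Formula.eval
    rw [value_relabel, Function.comp_assoc, f.symm_comp_self, Function.comp_id]
  rw [← h, ← h x]
  exact e.map_formula k (BoundedFormula.relabel f ψ) (x ∘ f.symm)

/-- The connective which measures the largest distance of the arguments from given values. -/
noncomputable def distConnective {k : ℕ} (r : Fin k → I) : C(Fin k → I, I) :=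
  ⟨fun v => Set.projIcc 0 1 zero_le_one (dist v r), by fun_prop⟩

/-- Every type is approximated, on finitely many instances, by realised types. -/
theorem IsPhiType.exists_approx {φ : Formula L (Fin m ⊕ Fin n)} {p : (Fin n → M) → I}
    (hp : IsPhiType φ M p) {k : ℕ} (b : Fin k → Fin n → M) {ε : ℝ} (hε : 0 < ε) :
    ∃ a : Fin m → M, ∀ i, dist (φ.eval₂ a (b i)) (p (b i)) < ε := by
  obtain ⟨N, _, _, e, a, ha⟩ := hp
  let g : Fin k → Fin m ⊕ Fin n → (Fin k × Fin n) ⊕ Fin m := fun i =>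
    Sum.elim .inr fun j => .inl (i, j)
  -- `χ` is the maximum over `i` of `|φ(x, b i) - p (b i)|`, with the entries of `b` as free
  -- variables and `x` to be quantified. In `N` its value at `a` is `0`, so by elementarity its
  -- infimum is below `t` in `M` as well.
  let χ : BoundedFormula L (Fin k × Fin n) m :=
    .conn (distConnective fun i => p (b i)) fun i => BoundedFormula.shift (g i) φ
  have hχ : ∀ {K : Type w} [MetricSpace K] [Structure L K] (y : Fin k → Fin n → K)
      (z : Fin m → K), χ.value (fun c => y c.1 c.2) z =
        distConnective (fun i => p (b i)) fun i => φ.eval₂ z (y i) := by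
    intro K _ _ y z
    simp only [χ, BoundedFormula.value]
    congr 1
    funext i
    refine (BoundedFormula.value_shift (g i) _ φ z).trans ?_
    unfold Formula.eval₂ Formula.eval
    congr 1
    · funext c
      cases c <;> rfl
    · exact Subsingleton.elim _ _
  let t : I := Set.projIcc 0 1 zero_le_one ε
  have ht : 0 < t := by
    refine Subtype.coe_lt_coe.1 ?_
    simp [t, Set.coe_projIcc, hε]
  have hN : χ.infs.eval (fun c => e.toFun (b c.1 c.2)) < t := by
    refine (BoundedFormula.eval_infs_lt_iff _ _ _).2 ⟨a, ?_⟩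
    rw [hχ fun i j => e.toFun (b i j)]
    have : (fun i => φ.eval₂ a fun j => e.toFun (b i j)) = fun i => p (b i) :=
      funext fun i => (ha (b i)).symm
    rw [this]
    convert ht
    simp [distConnective]
  have hM : χ.infs.eval (fun c => b c.1 c.2) < t :=
    (e.eval_map χ.infs fun c => b c.1 c.2).symm.trans_lt hN
  obtain ⟨a', ha'⟩ := (BoundedFormula.eval_infs_lt_iff _ _ _).1 hM
  rw [hχ] at ha'
  refine ⟨a', fun i => ?_⟩
  refine (dist_le_pi_dist (fun i => φ.eval₂ a' (b i)) (fun i => p (b i)) i).trans_lt ?_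
  exact lt_of_not_ge fun h => ha'.not_ge (Set.monotone_projIcc _ h)

/-- A basic neighbourhood in the product restricts only finitely many instances, so one `ε` serves
them all. -/
theorem IsPhiType.mem_closure_range {φ : Formula L (Fin m ⊕ Fin n)} {p : (Fin n → M) → I}
    (hp : IsPhiType φ M p) : p ∈ closure (Set.range fun (a : Fin m → M) b => φ.eval₂ a b) := by
  refine mem_closure_iff_nhds.2 fun s hs => ?_
  rw [nhds_pi] at hs
  obtain ⟨J, hJ, t, ht, hts⟩ := Filter.mem_pi.1 hs
  obtain ⟨ε, hεt, hε⟩ := ((hJ.eventually_all.2 fun b _ => by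
    obtain ⟨δ, hδ, hδt⟩ := Metric.mem_nhds_iff.1 (ht b)
    filter_upwards [Ioo_mem_nhdsGT hδ] with ε hε
    exact (Metric.ball_subset_ball hε.2.le).trans hδt :
      ∀ᶠ ε in 𝓝[>] (0 : ℝ), ∀ b ∈ J, Metric.ball (p b) ε ⊆ t b).and
        self_mem_nhdsWithin).exists
  have := hJ.to_subtype
  obtain ⟨k, ⟨f⟩⟩ := Finite.exists_equiv_fin J
  obtain ⟨a, ha⟩ := hp.exists_approx (fun i => (f.symm i : Fin n → M)) hε
  refine ⟨_, hts fun b hb => hεt b hb ?_, a, rfl⟩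
  simpa using ha (f ⟨b, hb⟩)

theorem isPhiType_iff_mem_closure_range {φ : Formula L (Fin m ⊕ Fin n)} {p : (Fin n → M) → I} :
    IsPhiType φ M p ↔ p ∈ closure (Set.range fun (a : Fin m → M) b => φ.eval₂ a b) :=
  ⟨IsPhiType.mem_closure_range, fun h =>
    (exists_ultrafilter_tendsto_of_mem_closure_range h).elim fun _ => isPhiType_of_tendsto⟩

theorem denseRange_typeOf (φ : Formula L (Fin m ⊕ Fin n)) :
    DenseRange (typeOf φ : (Fin m → M) → PhiType φ M) := by
  intro p
  rw [closure_subtype, ← Set.range_comp]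
  exact p.2.mem_closure_range

instance (φ : Formula L (Fin m ⊕ Fin n)) : CompactSpace (PhiType φ M) := by
  refine isCompact_iff_compactSpace.1 (IsClosed.isCompact ?_)
  have : {p | IsPhiType φ M p} = closure (Set.range fun (a : Fin m → M) b => φ.eval₂ a b) :=
    Set.ext fun _ => isPhiType_iff_mem_closure_range
  change IsClosed {p | IsPhiType φ M p}
  rw [this]
  exact isClosed_closure

end Compactness
-- Definability of types and the equivalences
section Stability

/-- By compactness `h` is a quotient map onto its closed image, so `f` descends to a continuous
function there; Tietze's theorem extends it to `X`. -/
theorem exists_continuousMap_comp_eq {T X : Type*} [TopologicalSpace T] [CompactSpace T]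
    [TopologicalSpace X] [T2Space X] [NormalSpace X] {h : T → X} (hh : Continuous h) {f : T → I}
    (hf : Continuous f) (hfac : f.FactorsThrough h) : ∃ θ : C(X, I), ∀ q, f q = θ (h q) := by
  let h' : C(T, Set.range h) := ⟨Set.rangeFactorization h, hh.subtype_mk _⟩
  have hq : IsQuotientMap h' := h'.continuous.isClosedMap.isQuotientMap h'.continuous
    Set.rangeFactorization_surjective
  have hfac' : Function.FactorsThrough (⟨f, hf⟩ : C(T, I)) h' := fun a b hab =>
    hfac (congrArg Subtype.val hab)
  obtain ⟨θ, hθ⟩ := (hq.lift ⟨f, hf⟩ hfac').exists_restrict_eq (isCompact_range hh).isClosed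
  refine ⟨θ, fun q => ?_⟩
  have h1 := DFunLike.congr_fun hθ (h' q)
  have h2 := DFunLike.congr_fun (hq.lift_comp ⟨f, hf⟩ hfac') q
  exact (h1.trans h2).symm

variable {L : Language.{u, v}} {m n : ℕ} {φ : Formula L (Fin m ⊕ Fin n)}
  {M : Type w} [MetricSpace M] [Structure L M]

theorem PhiType.ev_typeOf (a : Fin m → M) (b : Fin n → M) :
    PhiType.ev b (typeOf φ a) = φ.eval₂ a b :=
  rfl

theorem PhiType.ev_typeOf_swap (a : Fin m → M) (b : Fin n → M) :
    PhiType.ev a (typeOf φ.swap b) = φ.eval₂ a b :=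
  φ.eval₂_swap a b

/-- A function to which instances of a formula converge pointwise is a predicate. -/
theorem exists_phiPredicate_of_tendsto {f : PhiType φ M → I} (hf : Continuous f)
    {b : ℕ → Fin n → M}
    (h : ∀ p, Tendsto (fun k => PhiType.ev (b k) p) atTop (𝓝 (f p))) :
    ∃ ψ : PhiPredicate φ M, ψ.toFun = f := by
  obtain ⟨θ, hθ⟩ := exists_continuousMap_comp_eq (h := fun p k => PhiType.ev (b k) p)
    (continuous_pi fun k => PhiType.continuous_ev (b k)) hf fun p q hpq =>
      tendsto_nhds_unique (h p) ((h q).congr fun k => (congrFun hpq k).symm)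
  exact ⟨⟨f, b, θ, hθ⟩, rfl⟩

/-- In a stable situation, the formula extends to a separately continuous function on types. -/
theorem Formula.StableIn.exists_separately_continuous (h : φ.StableIn M) :
    ∃ Φ : PhiType φ M → PhiType φ.swap M → I, (∀ p, Continuous (Φ p)) ∧
      (∀ q, Continuous fun p => Φ p q) ∧ (∀ p b, Φ p (typeOf φ.swap b) = PhiType.ev b p) ∧
        ∀ a q, Φ (typeOf φ a) q = PhiType.ev a q :=
  exists_separately_continuous_extension (denseRange_typeOf φ) (denseRange_typeOf φ.swap) φ.eval₂ h
    PhiType.ev PhiType.ev PhiType.continuous_ev PhiType.continuous_ev PhiType.ev_typeOf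
    PhiType.ev_typeOf_swap

theorem tendsto_typeOf_iff {ι : Type*} {l : Filter ι} {a : ι → Fin m → M} {p : PhiType φ M} :
    Tendsto (fun k => typeOf φ (a k)) l (𝓝 p) ↔
      ∀ b, Tendsto (fun k => φ.eval₂ (a k) b) l (𝓝 (PhiType.ev b p)) :=
  tendsto_subtype_rng.trans tendsto_pi_nhds

/-- A separately continuous extension of a formula to types is approximated by sequences of
instances. -/
theorem exists_seq_tendsto_of_separately_continuous {Φ : PhiType φ M → PhiType φ.swap M → I}
    (h₁ : ∀ p, Continuous (Φ p)) (h₂ : ∀ q, Continuous fun p => Φ p q)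
    (h₃ : ∀ a q, Φ (typeOf φ a) q = PhiType.ev a q) (p : PhiType φ M) :
    ∃ a : ℕ → Fin m → M, ∀ q, Tendsto (fun k => PhiType.ev (a k) q) atTop (𝓝 (Φ p q)) := by
  obtain ⟨U, hU⟩ := exists_ultrafilter_tendsto_of_mem_closure_range (denseRange_typeOf φ p)
  obtain ⟨a, -, ha⟩ := exists_seq_tendsto_of_mapClusterPt h₁ h₂ hU.mapClusterPt
    (fun _ _ => True) fun _ => .of_forall fun _ => trivial
  exact ⟨a, fun q => by simpa only [h₃] using ha q⟩

theorem Formula.StableIn.exists_seq_tendsto (h : φ.StableIn M) (p : PhiType φ M) :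
    ∃ a : ℕ → Fin m → M, Tendsto (fun k => typeOf φ (a k)) atTop (𝓝 p) := by
  obtain ⟨Φ, h₁, h₂, h₃, h₄⟩ := h.exists_separately_continuous
  obtain ⟨a, ha⟩ := exists_seq_tendsto_of_separately_continuous h₁ h₂ h₄ p
  refine ⟨a, tendsto_typeOf_iff.2 fun b => ?_⟩
  simpa only [h₃, PhiType.ev_typeOf_swap] using ha (typeOf φ.swap b)

theorem continuous_toWeakSpace_iff {X E : Type*} [TopologicalSpace X] [NormedAddCommGroup E]
    [NormedSpace ℂ E] {f : X → E} :
    Continuous (fun x => toWeakSpace ℂ E (f x)) ↔ ∀ Λ : E →L[ℂ] ℂ, Continuous fun x => Λ (f x) := by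
  refine ⟨fun h Λ => (WeakBilin.eval_continuous (topDualPairing ℂ E).flip Λ).comp h, fun h => ?_⟩
  exact WeakBilin.continuous_of_continuous_eval (topDualPairing ℂ E).flip h

/-- A family of predicates which is separately continuous is continuous for the weak topology. -/
theorem continuous_toWeakSpace_of_separately_continuous {S : Type*} [TopologicalSpace S]
    [CompactSpace S] (ψ : S → PhiPredicate φ M) (h : ∀ p, Continuous fun s => (ψ s).toFun p) :
    Continuous fun s => toWeakSpace ℂ (PhiType φ M →ᵇ ℂ) (ψ s).toBCF := by
  refine continuous_toWeakSpace_iff.2 fun Λ => continuous_iff_continuousAt.2 fun s => ?_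
  let r : S → PhiType φ M →ᵇ ℝ := fun s => BoundedContinuousFunction.mkOfCompact
    ⟨fun p => ((ψ s).toFun p : ℝ), continuous_subtype_val.comp (ψ s).continuous⟩
  have hr : ∀ s, Complex.ofRealCLM.compLeftContinuousBounded _ (r s) = (ψ s).toBCF := fun s => by
    ext p
    rfl
  by_contra hcon
  obtain ⟨V, hV, hVs⟩ := not_tendsto_iff_exists_frequently_notMem.1 hcon
  -- The weak topology need not be sequential, but a failure of continuity at `s` puts `s` in the
  -- closure of the bad points, and the angelic property extracts a sequence of bad points whose
  -- predicates converge pointwise to that of `s`.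
  obtain ⟨t, -, ht⟩ := exists_seq_tendsto_of_mapClusterPt (Φ := fun s p => (ψ s).toFun p)
    (fun s => (ψ s).continuous) h (J := {s' | Λ (ψ s').toBCF ∉ V}) (l := comap (↑) (𝓝 s))
    (x := (↑)) (p := s) (by
      have : (comap ((↑) : {s' | Λ (ψ s').toBCF ∉ V} → S) (𝓝 s)).NeBot :=
        comap_nhds_neBot_of_mem_closure_range
          (by rw [Subtype.range_coe]; exact mem_closure_iff_frequently.2 hVs)
      exact tendsto_comap.mapClusterPt)
    (fun _ _ => True) fun _ => .of_forall fun _ => trivial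
  have hlim := tendsto_functional_of_pointwise Λ (f := fun k => r (t k)) (g := r s) (C := 1)
    (fun k p => (abs_of_nonneg ((ψ (t k)).toFun p).2.1).trans_le ((ψ (t k)).toFun p).2.2)
    fun p => (continuous_subtype_val.tendsto _).comp (ht p)
  simp only [hr] at hlim
  obtain ⟨k, hk⟩ := (hlim.eventually hV).exists
  exact (t k).2 hk

/-- Both sides are continuous in `q` and agree on the dense set of realised types. -/
theorem PhiPredicate.eval_swap_typeOf {ψ : PhiPredicate φ.swap M} {a : Fin m → M}
    (h : ψ.Defines (typeOf φ a)) (q : PhiType φ.swap M) : ψ.toFun q = PhiType.ev a q := by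
  refine congrFun ((denseRange_typeOf φ.swap).equalizer ψ.continuous (PhiType.continuous_ev a)
    (funext fun b => ?_)) q
  exact (h b).symm.trans (PhiType.ev_typeOf_swap a b).symm

theorem Formula.StableIn.exists_weak_embedding (h : φ.StableIn M) :
    ∃ ψ : PhiType φ M → PhiPredicate φ.swap M, (∀ p, (ψ p).Defines p) ∧
      IsEmbedding fun p => toWeakSpace ℂ (PhiType φ.swap M →ᵇ ℂ) (ψ p).toBCF := by
  obtain ⟨Φ, h₁, h₂, h₃, h₄⟩ := h.exists_separately_continuous
  choose ψ hψ using fun p =>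
    (exists_seq_tendsto_of_separately_continuous h₁ h₂ h₄ p).elim fun _ ha =>
      exists_phiPredicate_of_tendsto (h₁ p) ha
  refine ⟨ψ, fun p b => ?_, ?_⟩
  · rw [PhiPredicate.eval, hψ, h₃]
  -- A continuous injection of a compact space into a Hausdorff one is an embedding; it is injective
  -- because a definition determines its type.
  · refine (Continuous.isClosedEmbedding (continuous_toWeakSpace_of_separately_continuous ψ
      fun q => by simpa only [hψ] using h₂ q)
      fun p p' hpp' => Subtype.ext (funext fun b => ?_)).isEmbedding
    have := DFunLike.congr_fun ((toWeakSpace ℂ _).injective hpp') (typeOf φ.swap b)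
    have : (ψ p).toFun (typeOf φ.swap b) = (ψ p').toFun (typeOf φ.swap b) :=
      Subtype.ext (Complex.ofReal_injective this)
    rw [hψ, hψ, h₃, h₃] at this
    exact this

theorem exists_subseq_tendsto_of_weakly_continuous {ψ : PhiType φ M → PhiPredicate φ.swap M}
    (hdef : ∀ p, (ψ p).Defines p)
    (hψ : Continuous fun p => toWeakSpace ℂ (PhiType φ.swap M →ᵇ ℂ) (ψ p).toBCF)
    {a : ℕ → Fin m → M} {p : PhiType φ M} (hp : MapClusterPt p atTop fun k => typeOf φ (a k)) :
    ∃ s : ℕ → ℕ, StrictMono s ∧ ∃ ψ : PhiPredicate φ.swap M, ψ.Defines p ∧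
      ∀ q, Tendsto (fun k => PhiType.ev (a (s k)) q) atTop (𝓝 (ψ.toFun q)) := by
  have hcont : ∀ q, Continuous fun p => (ψ p).toFun q := fun q => by
    have := continuous_toWeakSpace_iff.1 hψ (BoundedContinuousFunction.evalCLM ℂ q)
    exact (Complex.continuous_re.comp this).subtype_mk _
  -- The side condition `<` makes the extracted indices a genuine subsequence.
  obtain ⟨s, hs, hs'⟩ := exists_seq_tendsto_of_mapClusterPt (Φ := fun p q => (ψ p).toFun q)
    (fun p => (ψ p).continuous) hcont hp (· < ·) eventually_gt_atTop
  refine ⟨s, strictMono_nat_of_lt_succ hs, ψ p, hdef p, fun q => ?_⟩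
  simpa only [PhiPredicate.eval_swap_typeOf (hdef _)] using hs' q

/-- Let `p`, `q` be limits of the types of the `a k`, `b l` along an ultrafilter, and `ψ` the
definition of `p` from the hypothesis. Then `r` is the limit of `φ(a k, q)`, which along the
subsequence is `ψ q`; and `s` is the limit of `ψ (b l)`, which is `ψ q` by continuity. -/
theorem stableIn_of_exists_subseq_tendsto
    (h : ∀ (a : ℕ → Fin m → M) (p : PhiType φ M), MapClusterPt p atTop (fun k => typeOf φ (a k)) →
      ∃ s : ℕ → ℕ, StrictMono s ∧ ∃ ψ : PhiPredicate φ.swap M, ψ.Defines p ∧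
        ∀ q : PhiType φ.swap M,
          Tendsto (fun k => PhiType.ev (a (s k)) q) atTop (𝓝 (ψ.toFun q))) : φ.StableIn M := by
  intro a b f g r s hf hr hg hs
  have hp : Tendsto (fun k => typeOf φ (a k)) (hyperfilter ℕ) (𝓝 _) := tendsto_lim_map _ _
  have hq : Tendsto (fun l => typeOf φ.swap (b l)) (hyperfilter ℕ) (𝓝 _) := tendsto_lim_map _ _
  set p := ((hyperfilter ℕ).map fun k => typeOf φ (a k)).lim
  set q := ((hyperfilter ℕ).map fun l => typeOf φ.swap (b l)).lim
  have hle : (hyperfilter ℕ : Filter ℕ) ≤ atTop := Nat.hyperfilter_le_atTop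
  obtain ⟨t, ht, ψ, hψ, hlim⟩ := h a p (hp.mapClusterPt.mono hle)
  have hfq : ∀ k, f k = PhiType.ev (a k) q := fun k => by
    refine tendsto_nhds_unique ((hf k).mono_left hle) ?_
    simpa only [Function.comp_def, PhiType.ev_typeOf_swap] using
      ((PhiType.continuous_ev (a k)).tendsto q).comp hq
  have hgp : ∀ l, g l = ψ.toFun (typeOf φ.swap (b l)) := fun l => by
    refine (tendsto_nhds_unique ((hg l).mono_left hle) ?_).trans (hψ (b l))
    exact ((PhiType.continuous_ev (b l)).tendsto p).comp hp
  have h1 : r = ψ.toFun q := tendsto_nhds_unique (hr.comp ht.tendsto_atTop)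
    (by simpa only [Function.comp_def, hfq] using hlim q)
  have h2 : s = ψ.toFun q := by
    refine tendsto_nhds_unique (hs.mono_left hle) ?_
    exact ((ψ.continuous.tendsto q).comp hq).congr fun l => (hgp l).symm
  rw [h1, h2]

end Stability

end ContLogic

theorem mainTheorem3 {L : ContLogic.Language.{u, v}} {m n : ℕ}
    (φ : ContLogic.Formula L (Fin m ⊕ Fin n))
    (M : Type w) [MetricSpace M] [ContLogic.Structure L M] :
    List.TFAE
      [ -- (i)
        φ.StableIn M,
        -- (ii)
        ∃ ψ : ContLogic.PhiType φ M → ContLogic.PhiPredicate φ.swap M,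
          (∀ p, (ψ p).Defines p) ∧
          IsEmbedding (fun p => toWeakSpace ℂ (ContLogic.PhiType φ.swap M →ᵇ ℂ) (ψ p).toBCF),
        -- (iii)
        ∀ (a : ℕ → Fin m → M) (p : ContLogic.PhiType φ M),
          MapClusterPt p atTop (fun k => ContLogic.typeOf φ (a k)) →
          ∃ s : ℕ → ℕ, StrictMono s ∧ ∃ ψ : ContLogic.PhiPredicate φ.swap M, ψ.Defines p ∧
            ∀ q : ContLogic.PhiType φ.swap M,
              Tendsto (fun k => ContLogic.PhiType.ev (a (s k)) q) atTop (𝓝 (ψ.toFun q)) ] ∧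
    (φ.StableIn M → ∀ p : ContLogic.PhiType φ M, ∃ a : ℕ → Fin m → M,
      Tendsto (fun k => ContLogic.typeOf φ (a k)) atTop (𝓝 p)) := by
  refine ⟨?_, fun h => h.exists_seq_tendsto⟩
  tfae_have 1 → 2 := fun h => h.exists_weak_embedding
  tfae_have 2 → 3 := fun ⟨_, hdef, hψ⟩ _ _ hp =>
    ContLogic.exists_subseq_tendsto_of_weakly_continuous hdef hψ.continuous hp
  tfae_have 3 → 1 := ContLogic.stableIn_of_exists_subseq_tendsto
  tfae_finish
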